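/- For a partition $\pi$ of an integer and integers $A,a\ge 1$, let $\mathrm{mex}_{A,a}(\pi)$ be the smallest integer that is greater than or equal to $a$, congruent to $a$ modulo $A$, and not a part of $\pi$. Let $p_{A,a}(n)$ be the number of partitions $\pi$ of $n$ with $\mathrm{mex}_{A,a}(\pi)\equiv a \pmod{2A}$, and let $\overline{p}_{A,a}(n)$ be the number of partitions $\pi$ of $n$ with $\mathrm{mex}_{A,a}(\pi)\equiv A+a \pmod{2A}$. Let $spt(n)$ (Andrews' smallest parts function) be the total number of appearances of the smallest part, summed over all partitions of $n$, with $spt(0)=0$. Then for every integer $n\ge 0$, $$spt(n)=\sum_{r=0}^{n-1}(2r+1)\left[\overline{p}_{1,r+1}(n)-\overline{p}_{3,r+2}(n)\right]=\sum_{r=0}^{n-1}(2r+1)\left[p_{3,r+2}(n)-p_{1,r+1}(n)\right].$$ -/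

import Mathlib

/-- `mex_{A,a}(π)`: the smallest integer `≥ a` and congruent to `a` modulo `A` that is not a part
of the partition `π`. (For `A ≥ 1` the set is nonempty, as `π` has finitely many parts.) -/
noncomputable def mexAP (A a : ℕ) {n : ℕ} (π : n.Partition) : ℕ :=
  sInf {m : ℕ | a ≤ m ∧ m ≡ a [MOD A] ∧ m ∉ π.parts}

/-- `p_{A,a}(n)`: the number of partitions `π` of `n` with `mex_{A,a}(π) ≡ a (mod 2A)`. -/
noncomputable def pMex (A a n : ℕ) : ℕ :=
  (Finset.univ.filter fun π : n.Partition => mexAP A a π ≡ a [MOD 2 * A]).card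

/-- `p̄_{A,a}(n)`: the number of partitions `π` of `n` with `mex_{A,a}(π) ≡ A + a (mod 2A)`. -/
noncomputable def pBarMex (A a n : ℕ) : ℕ :=
  (Finset.univ.filter fun π : n.Partition => mexAP A a π ≡ A + a [MOD 2 * A]).card

/-- The smallest part of a partition (`0`, which is never a part, for the empty partition). -/
noncomputable def smallestPart {n : ℕ} (π : n.Partition) : ℕ :=
  sInf {m : ℕ | m ∈ π.parts}

/-- Andrews' smallest parts function: the total number of appearances of the smallest part in
each partition of `n`. -/
noncomputable def spt (n : ℕ) : ℕ :=
  ∑ π : n.Partition, π.parts.count (smallestPart π)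

/-! Write (q)_n for `qPoch n` and P for the partition generating function. Marking each copy of the
smallest part gives Σ spt(n) qⁿ = P · Σ_{m≥1} (q)_{m-1} q^m/(1-q^m). By `bailey_pair` and
`conj_bailey` this sum equals Σ_{j≥1} (-1)^{j-1} (1+q^j)/(1-q^j)² · (q^{j(j+1)/2} - q^{j(3j+1)/2})
(`andrews_identity`). Expanding (1+x)/(1-x)² = Σ (2r+1) x^r at x = q^j adds r to each of the j terms
of the progressions whose sums are the exponents. The alternating sums over j that result generate
p̄_{1,r+1} - p̄_{3,r+2}, because the mex is governed by the parity of an initial run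
(`pBarMex_eq_coeff`). Infinite sums are replaced by finite ones modulo X^(N+1). -/

open PowerSeries in
/-- The finite `q`-Pochhammer product `(1 - X) (1 - X ^ 2) ⋯ (1 - X ^ n)`. -/
noncomputable def qPoch (n : ℕ) : PowerSeries ℚ :=
  ∏ i ∈ Finset.range n, (1 - (X : PowerSeries ℚ) ^ (i + 1))

/-- The inverse of the finite `q`-Pochhammer product. -/
noncomputable def qPochInv (n : ℕ) : PowerSeries ℚ := (qPoch n)⁻¹

/-- `1 / (q)_{n - r}`, with value `0` for `n < r`. -/
noncomputable def qPochInvSub (n r : ℕ) : PowerSeries ℚ :=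
  if r ≤ n then qPochInv (n - r) else 0

/-! ### Finite q-Pochhammer symbols -/

section QSeries

open PowerSeries Finset

lemma one_sub_X_pow_mul_inv (n : ℕ) :
    (1 - (X : PowerSeries ℚ) ^ (n + 1)) * (1 - (X : PowerSeries ℚ) ^ (n + 1))⁻¹ = 1 :=
  PowerSeries.mul_inv_cancel _ (by simp)

lemma qPoch_succ (n : ℕ) : qPoch (n + 1) = qPoch n * (1 - X ^ (n + 1)) := by
  simp [qPoch, prod_range_succ]

lemma qPoch_mul_inv (n : ℕ) : qPoch n * qPochInv n = 1 :=
  PowerSeries.mul_inv_cancel _ (by simp [qPoch, map_prod])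

lemma qPoch_zero : qPoch 0 = 1 := by simp [qPoch]

lemma qPochInv_zero : qPochInv 0 = 1 := by
  simpa [qPoch_zero] using qPoch_mul_inv 0

lemma qPochInv_eq (n : ℕ) : qPochInv n = (1 - X ^ (n + 1)) * qPochInv (n + 1) := by
  have h1 := qPoch_mul_inv n
  have h2 := qPoch_mul_inv (n + 1)
  rw [qPoch_succ] at h2
  linear_combination (1 - X ^ (n + 1)) * qPochInv (n + 1) * h1 - qPochInv n * h2

lemma qPochInvSub_add (r k : ℕ) : qPochInvSub (r + k) r = qPochInv k := by
  simp [qPochInvSub]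

lemma qPochInvSub_add_succ (r k : ℕ) :
    qPochInvSub (r + k) (r + 1) = (1 - X ^ k) * qPochInv k := by
  cases k with
  | zero => simp [qPochInvSub]
  | succ k =>
    rw [← qPochInv_eq, show r + (k + 1) = (r + 1) + k by ring, qPochInvSub_add]

lemma qPochInvSub_of_lt {n r : ℕ} (h : n < r) : qPochInvSub n r = 0 := by
  simp [qPochInvSub, Nat.not_le.2 h]

lemma qPochInvSub_succ_succ (n r : ℕ) :
    qPochInvSub (n + 1) (r + 1) = qPochInvSub n r := by
  simp [qPochInvSub]

lemma qPochInvSub_zero (n : ℕ) : qPochInvSub n 0 = qPochInv n := by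
  simp [qPochInvSub]

/-- The arithmetic series `∑_{i < r} (a + A i)`. -/
def arithSum (A a r : ℕ) : ℕ := ∑ i ∈ range r, (a + A * i)

lemma arithSum_succ (A a r : ℕ) : arithSum A a (r + 1) = arithSum A a r + (a + A * r) := by
  simp [arithSum, sum_range_succ]

lemma arithSum_zero (A a : ℕ) : arithSum A a 0 = 0 := by simp [arithSum]

lemma arithSum_add_left (A a b r : ℕ) : arithSum A (a + b) r = arithSum A a r + r * b := by
  simp [arithSum, sum_add_distrib]; ring

lemma le_arithSum (A a r : ℕ) : a * r ≤ arithSum A a r := by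
  simp only [arithSum, sum_add_distrib, sum_const, card_range, smul_eq_mul]
  nlinarith [Nat.zero_le (∑ i ∈ range r, A * i)]

/-! ### Bailey pairs -/

/-- Partial sums of the difference in `n` of the left side of the finite pentagonal identity. -/
lemma pentagonal_telescope (n R : ℕ) :
    (qPoch (n + 1) * qPochInv (n + 1) ^ 2 - qPoch n * qPochInv n ^ 2) +
    ∑ r ∈ range R, (-1) ^ (r + 1) * X ^ arithSum 3 1 (r + 1) * (1 + X ^ (r + 1)) *
      (qPoch (n + 1) * qPochInvSub (n + 1) (r + 1) * qPochInv (n + 1 + (r + 1)) -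
        qPoch n * qPochInvSub n (r + 1) * qPochInv (n + (r + 1))) =
    (-1) ^ R * X ^ (arithSum 3 1 R + 2 * R + (n + 1)) * qPoch n *
      qPochInvSub n R * qPochInv (n + 1 + R) := by
  induction R with
  | zero =>
    simp only [range_zero, sum_empty, arithSum_zero, qPochInvSub_zero, qPoch_succ, add_zero]
    rw [qPochInv_eq n]
    ring
  | succ R ih =>
    rw [sum_range_succ, ← add_assoc, ih]
    rcases lt_or_ge n R with h | h
    · rw [qPochInvSub_succ_succ, qPochInvSub_of_lt h, qPochInvSub_of_lt (h.trans (Nat.lt_succ_self R))]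
      ring
    · obtain ⟨k, rfl⟩ := Nat.exists_eq_add_of_le h
      rw [qPochInvSub_succ_succ, qPochInvSub_add, qPochInvSub_add_succ, arithSum_succ, qPoch_succ,
        show R + k + (R + 1) = R + k + 1 + R by ring, qPochInv_eq (R + k + 1 + R),
        show R + k + 1 + (R + 1) = R + k + 1 + R + 1 by ring]
      ring

/-- The left side does not depend on n, by `pentagonal_telescope`, and is 1 at n = 0. This is a
Bailey pair with β_n = 1/(q)_n. -/
lemma pentagonal_finite (n : ℕ) : ∀ R, n ≤ R →
    qPoch n * (qPochInv n ^ 2 +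
    ∑ r ∈ range R, (-1) ^ (r + 1) * X ^ arithSum 3 1 (r + 1) * (1 + X ^ (r + 1)) *
      (qPochInvSub n (r + 1) * qPochInv (n + (r + 1)))) = 1 := by
  induction n with
  | zero =>
    intro R _
    rw [sum_eq_zero]
    · simp [qPoch_zero, qPochInv_zero]
    · intro r _
      rw [qPochInvSub_of_lt (Nat.succ_pos r)]; ring
  | succ n ih =>
    intro R hR
    have h := pentagonal_telescope n R
    -- The telescoped remainder carries 1/(q)_{n-R}, which is 0 by convention.
    rw [qPochInvSub_of_lt (show n < R by omega)] at h
    have h2 := ih R (by omega)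
    simp only [mul_sub, sum_sub_distrib] at h
    rw [mul_add, mul_sum] at h2 ⊢
    have e1 : ∀ m, ∑ r ∈ range R, (-1) ^ (r + 1) * X ^ arithSum 3 1 (r + 1) * (1 + X ^ (r + 1)) *
        (qPoch m * qPochInvSub m (r + 1) * qPochInv (m + (r + 1))) =
        ∑ r ∈ range R, qPoch m * ((-1) ^ (r + 1) * X ^ arithSum 3 1 (r + 1) * (1 + X ^ (r + 1)) *
        (qPochInvSub m (r + 1) * qPochInv (m + (r + 1)))) :=
      fun m => sum_congr rfl fun r _ => by ring
    rw [e1, e1] at h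
    linear_combination h + h2

/-- Unlike the pentagonal case, the sum over r telescopes by itself, with no differencing in n. -/
lemma triangular_telescope (n R : ℕ) :
    (1 - X ^ (n + 1)) * (qPochInv (n + 1) ^ 2 +
    ∑ r ∈ range R, (-1) ^ (r + 1) * X ^ arithSum 1 0 (r + 1) * (1 + X ^ (r + 1)) *
      (qPochInvSub (n + 1) (r + 1) * qPochInv (n + 1 + (r + 1)))) =
    (-1) ^ R * X ^ (arithSum 1 0 R + R) * qPochInvSub n R * qPochInv (n + 1 + R) := by
  induction R with
  | zero =>
    simp only [range_zero, sum_empty, arithSum_zero, qPochInvSub_zero, add_zero]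
    rw [qPochInv_eq n]
    ring
  | succ R ih =>
    rw [sum_range_succ, ← add_assoc, mul_add, ih]
    rcases lt_or_ge n R with h | h
    · rw [qPochInvSub_succ_succ, qPochInvSub_of_lt h, qPochInvSub_of_lt (h.trans (Nat.lt_succ_self R))]
      ring
    · obtain ⟨k, rfl⟩ := Nat.exists_eq_add_of_le h
      rw [qPochInvSub_succ_succ, qPochInvSub_add, qPochInvSub_add_succ, arithSum_succ,
        qPochInv_eq (R + k + 1 + R),
        show R + k + 1 + (R + 1) = R + k + 1 + R + 1 by ring]
      ring

lemma triangular_finite (n R : ℕ) (h : n + 1 ≤ R) :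
    qPochInv (n + 1) ^ 2 +
    ∑ r ∈ range R, (-1) ^ (r + 1) * X ^ arithSum 1 0 (r + 1) * (1 + X ^ (r + 1)) *
      (qPochInvSub (n + 1) (r + 1) * qPochInv (n + 1 + (r + 1))) = 0 := by
  have h1 := triangular_telescope n R
  rw [qPochInvSub_of_lt (show n < R by omega)] at h1
  have h2 := one_sub_X_pow_mul_inv n
  linear_combination (1 - X ^ (n + 1))⁻¹ * h1 - (qPochInv (n + 1) ^ 2 +
    ∑ r ∈ range R, (-1) ^ (r + 1) * X ^ arithSum 1 0 (r + 1) * (1 + X ^ (r + 1)) *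
      (qPochInvSub (n + 1) (r + 1) * qPochInv (n + 1 + (r + 1)))) * h2

/-- The sequence `α` of the Bailey pair used for the smallest parts function, at `r + 1`. -/
noncomputable def baileyAlpha (r : ℕ) : PowerSeries ℚ :=
  (-1) ^ r * (1 + X ^ (r + 1)) * (X ^ arithSum 1 0 (r + 1) - X ^ arithSum 3 1 (r + 1))

/-- Subtracting the unit Bailey pair (β_n = 0 for n ≥ 1) from the pentagonal one keeps β_n and
cancels α_0, whose conjugate factor q^r/(1-q^r)² would have a pole at r = 0. -/
lemma bailey_pair (n R : ℕ) (h : n + 1 ≤ R) :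
    ∑ r ∈ range R, baileyAlpha r *
      (qPochInvSub (n + 1) (r + 1) * qPochInv (n + 1 + (r + 1))) = qPochInv (n + 1) := by
  have h1 := pentagonal_finite (n + 1) R h
  have h2 := triangular_finite n R h
  have h3 := qPoch_mul_inv (n + 1)
  have e : ∑ r ∈ range R, baileyAlpha r *
      (qPochInvSub (n + 1) (r + 1) * qPochInv (n + 1 + (r + 1))) =
      ∑ r ∈ range R, (-1) ^ (r + 1) * X ^ arithSum 3 1 (r + 1) * (1 + X ^ (r + 1)) *
      (qPochInvSub (n + 1) (r + 1) * qPochInv (n + 1 + (r + 1))) -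
      ∑ r ∈ range R, (-1) ^ (r + 1) * X ^ arithSum 1 0 (r + 1) * (1 + X ^ (r + 1)) *
      (qPochInvSub (n + 1) (r + 1) * qPochInv (n + 1 + (r + 1))) := by
    rw [← sum_sub_distrib]
    exact sum_congr rfl fun r _ => by rw [baileyAlpha]; ring
  rw [e]
  set S := ∑ r ∈ range R, (-1) ^ (r + 1) * X ^ arithSum 3 1 (r + 1) * (1 + X ^ (r + 1)) *
      (qPochInvSub (n + 1) (r + 1) * qPochInv (n + 1 + (r + 1)))
  linear_combination qPochInv (n + 1) * h1 - h2 - (S + qPochInv (n + 1) ^ 2) * h3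

/-! ### Conjugate Bailey pair and Andrews' identity -/

/-- The summand of the conjugate Bailey pair, at `n = m + 1`. -/
noncomputable def conjTerm (m r : ℕ) : PowerSeries ℚ :=
  qPoch m ^ 2 * X ^ (m + 1) * (qPochInvSub (m + 1) r * qPochInv (m + 1 + r))

/-- The telescoping certificate for the conjugate Bailey pair. -/
noncomputable def conjCert (m r : ℕ) : PowerSeries ℚ :=
  (1 - X ^ (2 * r + 1)) * X ^ (m + 1) * qPoch m ^ 2 *
    (qPochInvSub m r * qPochInv (m + 1 + r))

lemma conjTerm_telescope (m r : ℕ) :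
    (1 - X ^ (r + 1)) ^ 2 * conjTerm m (r + 1) - X * (1 - X ^ r) ^ 2 * conjTerm m r =
      conjCert m r - conjCert (m + 1) r := by
  simp only [conjTerm, conjCert, qPochInvSub_succ_succ]
  rcases lt_trichotomy r (m + 1) with h | rfl | h
  · obtain ⟨k, rfl⟩ := Nat.exists_eq_add_of_le (Nat.le_of_lt_succ h)
    rw [qPochInvSub_add, show r + k + 1 = r + (k + 1) by ring, qPochInvSub_add, qPochInv_eq k,
      show r + (k + 1) + (r + 1) = r + (k + 1) + r + 1 by ring,
      qPochInv_eq (r + (k + 1) + r), ← add_assoc r k 1, qPoch_succ,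
      show r + k + 1 + 1 + r = r + k + 1 + r + 1 by ring]
    ring
  · rw [qPochInvSub_of_lt (Nat.lt_succ_self m),
      show m + 1 + 1 + (m + 1) = m + 1 + (m + 1) + 1 by ring, qPochInv_eq (m + 1 + (m + 1)),
      qPoch_succ]
    ring
  · rw [qPochInvSub_of_lt h, qPochInvSub_of_lt (Nat.lt_of_succ_lt h)]
    ring

lemma conjTerm_sum_step (N r : ℕ) :
    (1 - X ^ (r + 1)) ^ 2 * ∑ m ∈ range N, conjTerm m (r + 1) -
      X * (1 - X ^ r) ^ 2 * ∑ m ∈ range N, conjTerm m r = conjCert 0 r - conjCert N r := by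
  rw [mul_sum, mul_sum, ← sum_sub_distrib, sum_congr rfl fun m _ => conjTerm_telescope m r,
    sum_range_sub']

lemma X_pow_dvd_conjCert (N r : ℕ) : (X : PowerSeries ℚ) ^ (N + 1) ∣ conjCert N r :=
  ⟨(1 - X ^ (2 * r + 1)) * qPoch N ^ 2 * (qPochInvSub N r * qPochInv (N + 1 + r)), by
    rw [conjCert]; ring⟩

lemma conjCert_zero_zero : conjCert 0 0 = X := by
  have h := qPoch_mul_inv 1
  rw [qPoch_succ, qPoch_zero] at h
  simp only [conjCert, qPoch_zero, qPochInvSub_zero, qPochInv_zero]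
  linear_combination X * h

/-- At r = 0 the factor (1 - X^0)² removes `conjTerm m 0`, and `conjCert 0 0` = X starts the
recursion. Each later step multiplies by X, up to the error `conjCert N r`. -/
lemma conj_bailey_aux (N r : ℕ) : (X : PowerSeries ℚ) ^ (N + 1) ∣
    (1 - X ^ (r + 1)) ^ 2 * ∑ m ∈ range N, conjTerm m (r + 1) - X ^ (r + 1) := by
  induction r with
  | zero =>
    have h := conjTerm_sum_step N 0
    rw [conjCert_zero_zero] at h
    convert (X_pow_dvd_conjCert N 0).neg_right using 1
    linear_combination h
  | succ r ih =>
    have h := conjTerm_sum_step N (r + 1)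
    have h0 : conjCert 0 (r + 1) = 0 := by
      rw [conjCert, qPochInvSub_of_lt (Nat.succ_pos r)]; ring
    rw [h0] at h
    convert (ih.mul_left X).sub (X_pow_dvd_conjCert N (r + 1)) using 1
    linear_combination h

lemma conj_bailey (N r : ℕ) : (X : PowerSeries ℚ) ^ (N + 1) ∣
    ∑ m ∈ range N, conjTerm m (r + 1) - X ^ (r + 1) * ((1 - X ^ (r + 1))⁻¹) ^ 2 := by
  have h := one_sub_X_pow_mul_inv r
  convert (conj_bailey_aux N r).mul_left (((1 - X ^ (r + 1))⁻¹) ^ 2) using 1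
  set u := (1 - (X : PowerSeries ℚ) ^ (r + 1))⁻¹
  linear_combination (-(∑ m ∈ range N, conjTerm m (r + 1)) *
    ((1 - X ^ (r + 1)) * u + 1)) * h

lemma qPoch_mul_inv_eq_sum (N m : ℕ) (h : m < N) :
    qPoch m * X ^ (m + 1) * (1 - X ^ (m + 1))⁻¹ =
      ∑ r ∈ range N, baileyAlpha r * conjTerm m (r + 1) := by
  have e : ∑ r ∈ range N, baileyAlpha r * conjTerm m (r + 1) =
      qPoch m ^ 2 * X ^ (m + 1) * qPochInv (m + 1) := by
    rw [← bailey_pair m N h, mul_sum]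
    exact sum_congr rfl fun r _ => by rw [conjTerm]; ring
  rw [e]
  have h1 := one_sub_X_pow_mul_inv m
  have h2 := qPoch_mul_inv (m + 1)
  rw [qPoch_succ] at h2
  set u := (1 - (X : PowerSeries ℚ) ^ (m + 1))⁻¹
  linear_combination (-qPoch m * X ^ (m + 1) * u) * h2 +
    qPoch m ^ 2 * X ^ (m + 1) * qPochInv (m + 1) * h1

/-- Andrews' identity for the smallest parts function, modulo `X ^ (N + 1)`. -/
lemma andrews_identity (N : ℕ) : (X : PowerSeries ℚ) ^ (N + 1) ∣
    ∑ m ∈ range N, qPoch m * X ^ (m + 1) * (1 - X ^ (m + 1))⁻¹ -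
      ∑ r ∈ range N, (-1) ^ r * (1 + X ^ (r + 1)) * ((1 - X ^ (r + 1))⁻¹) ^ 2 *
        (X ^ arithSum 1 1 (r + 1) - X ^ arithSum 3 2 (r + 1)) := by
  -- Bailey's lemma: expand β through α and exchange the sums.
  rw [sum_congr rfl fun m hm => qPoch_mul_inv_eq_sum N m (mem_range.1 hm), sum_comm,
    ← sum_sub_distrib]
  refine dvd_sum fun r _ => ?_
  convert (conj_bailey N r).mul_left (baileyAlpha r) using 1
  rw [mul_sub, ← mul_sum, baileyAlpha, show arithSum 1 1 (r + 1) = arithSum 1 0 (r + 1) + (r + 1) by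
      simpa using arithSum_add_left 1 0 1 (r + 1),
    show arithSum 3 2 (r + 1) = arithSum 3 1 (r + 1) + (r + 1) by
      simpa using arithSum_add_left 3 1 1 (r + 1)]
  ring

/-! ### Truncated series expansions -/

lemma sum_odd_mul_pow {R : Type*} [CommRing R] (x : R) (N : ℕ) :
    (∑ r ∈ range N, (2 * (r : R) + 1) * x ^ r) * (1 - x) ^ 2 =
      1 + x - x ^ N * (2 * N + 1 - (2 * N - 1) * x) := by
  induction N with
  | zero => simp
  | succ N ih => rw [sum_range_succ, add_mul, ih]; push_cast; ring

lemma sum_odd_mul_X_pow (N k : ℕ) : (X : PowerSeries ℚ) ^ N ∣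
    ∑ r ∈ range N, (2 * (r : PowerSeries ℚ) + 1) * (X ^ (k + 1)) ^ r -
      (1 + X ^ (k + 1)) * ((1 - X ^ (k + 1))⁻¹) ^ 2 := by
  have h := sum_odd_mul_pow ((X : PowerSeries ℚ) ^ (k + 1)) N
  have h1 := one_sub_X_pow_mul_inv k
  set u := (1 - (X : PowerSeries ℚ) ^ (k + 1))⁻¹
  set S := ∑ r ∈ range N, (2 * (r : PowerSeries ℚ) + 1) * (X ^ (k + 1)) ^ r
  refine ⟨-(X ^ (k * N) * u ^ 2 *
    (2 * (N : PowerSeries ℚ) + 1 - (2 * (N : PowerSeries ℚ) - 1) * X ^ (k + 1))), ?_⟩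
  linear_combination u ^ 2 * h - S * ((1 - X ^ (k + 1)) * u + 1) * h1

lemma sum_X_pow_mul (N m : ℕ) : (X : PowerSeries ℚ) ^ (N + 1) ∣
    ∑ j ∈ range N, X ^ ((j + 1) * (m + 1)) - X ^ (m + 1) * (1 - X ^ (m + 1))⁻¹ := by
  have h := geom_sum_mul ((X : PowerSeries ℚ) ^ (m + 1)) N
  have h1 := one_sub_X_pow_mul_inv m
  have e : ∑ j ∈ range N, (X : PowerSeries ℚ) ^ ((j + 1) * (m + 1)) =
      X ^ (m + 1) * ∑ j ∈ range N, (X ^ (m + 1)) ^ j := by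
    rw [mul_sum]
    exact sum_congr rfl fun j _ => by ring
  rw [e]
  set u := (1 - (X : PowerSeries ℚ) ^ (m + 1))⁻¹
  set S := ∑ j ∈ range N, ((X : PowerSeries ℚ) ^ (m + 1)) ^ j
  refine ⟨-(X ^ (m * (N + 1)) * u), ?_⟩
  linear_combination (-X ^ (m + 1) * u) * h - X ^ (m + 1) * S * h1

/-- The polynomial form of Andrews' identity, modulo `X ^ (N + 1)`. -/
lemma andrews_identity_truncated (N : ℕ) : (X : PowerSeries ℚ) ^ (N + 1) ∣
    ∑ m ∈ range N, ∑ j ∈ range N, qPoch m * X ^ ((j + 1) * (m + 1)) -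
      ∑ r ∈ range N, (2 * (r : PowerSeries ℚ) + 1) * ∑ j ∈ range N, (-1) ^ j *
        (X ^ arithSum 1 (r + 1) (j + 1) - X ^ arithSum 3 (r + 2) (j + 1)) := by
  have hL : (X : PowerSeries ℚ) ^ (N + 1) ∣
      ∑ m ∈ range N, ∑ j ∈ range N, qPoch m * X ^ ((j + 1) * (m + 1)) -
      ∑ m ∈ range N, qPoch m * X ^ (m + 1) * (1 - X ^ (m + 1))⁻¹ := by
    rw [← sum_sub_distrib]
    refine dvd_sum fun m _ => ?_
    convert (sum_X_pow_mul N m).mul_left (qPoch m) using 1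
    rw [mul_sub, mul_sum, mul_assoc]
  have hR : (X : PowerSeries ℚ) ^ (N + 1) ∣
      ∑ r ∈ range N, (2 * (r : PowerSeries ℚ) + 1) * ∑ j ∈ range N, (-1) ^ j *
        (X ^ arithSum 1 (r + 1) (j + 1) - X ^ arithSum 3 (r + 2) (j + 1)) -
      ∑ j ∈ range N, (-1) ^ j * (1 + X ^ (j + 1)) * ((1 - X ^ (j + 1))⁻¹) ^ 2 *
        (X ^ arithSum 1 1 (j + 1) - X ^ arithSum 3 2 (j + 1)) := by
    simp only [mul_sum]
    rw [sum_comm, ← sum_sub_distrib]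
    refine dvd_sum fun j _ => ?_
    -- The expansion is exact only modulo X^N; this factor supplies the missing X.
    have hX : (X : PowerSeries ℚ) ∣ X ^ arithSum 1 1 (j + 1) - X ^ arithSum 3 2 (j + 1) := by
      refine (dvd_pow_self _ ?_).sub (dvd_pow_self _ ?_)
      · have := le_arithSum 1 1 (j + 1); omega
      · have := le_arithSum 3 2 (j + 1); omega
    have hd := mul_dvd_mul (sum_odd_mul_X_pow N j) hX
    rw [← pow_succ] at hd
    convert hd.mul_left ((-1) ^ j) using 1
    rw [sub_mul, mul_sub ((-1) ^ j), sum_mul, mul_sum]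
    congr 1
    · refine sum_congr rfl fun r _ => ?_
      rw [add_comm r 1, add_comm r 2, arithSum_add_left, arithSum_add_left]
      ring
    · ring
  convert (hL.sub hR).add (andrews_identity N) using 1
  ring

end QSeries

/-! ### Generating functions of partitions and spt -/

section PartitionCounts

open PowerSeries Finset

open Classical in
/-- The generating function of the partitions all of whose parts are at least `m`. -/
noncomputable def partsGE (m : ℕ) : PowerSeries ℚ :=
  PowerSeries.mk fun n => ((univ.filter fun π : n.Partition => ∀ i ∈ π.parts, m ≤ i).card : ℚ)

open Classical in
-- Removing the parts in D is a bijection.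
lemma card_partition_containing (D : Multiset ℕ) (m n : ℕ) (hD : ∀ i ∈ D, 0 < i ∧ m ≤ i) :
    (univ.filter fun π : n.Partition => D ≤ π.parts ∧ ∀ i ∈ π.parts, m ≤ i).card =
      if D.sum ≤ n then
        (univ.filter fun π : (n - D.sum).Partition => ∀ i ∈ π.parts, m ≤ i).card else 0 := by
  split_ifs with h
  · symm
    refine card_bij
      (fun π _ => ⟨D + π.parts, ?_, ?_⟩) ?_ ?_ ?_
    · intro i hi
      rcases Multiset.mem_add.1 hi with hi | hi
      · exact (hD i hi).1
      · exact π.parts_pos hi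
    · rw [Multiset.sum_add, π.parts_sum]; omega
    · intro π hπ
      simp only [mem_filter, mem_univ, true_and] at hπ ⊢
      refine ⟨Multiset.le_add_right _ _, fun i hi => ?_⟩
      rcases Multiset.mem_add.1 hi with hi | hi
      · exact (hD i hi).2
      · exact hπ i hi
    · intro π _ π' _ he
      exact Nat.Partition.ext (by simpa using congrArg Nat.Partition.parts he)
    · intro π hπ
      simp only [mem_filter, mem_univ, true_and] at hπ
      have hs : D + (π.parts - D) = π.parts := add_tsub_cancel_of_le hπ.1
      have hsub : ∀ i ∈ π.parts - D, i ∈ π.parts := fun i hi =>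
        Multiset.mem_of_le (Multiset.sub_le_self _ _) hi
      refine ⟨⟨π.parts - D, fun hi => π.parts_pos (hsub _ hi), ?_⟩, ?_, Nat.Partition.ext hs⟩
      · have := congrArg Multiset.sum hs
        rw [Multiset.sum_add, π.parts_sum] at this
        omega
      · simpa using fun i hi => hπ.2 i (hsub i hi)
  · rw [card_eq_zero, filter_eq_empty_iff]
    rintro π - ⟨hle, -⟩
    obtain ⟨t, ht⟩ := Multiset.le_iff_exists_add.1 hle
    have := π.parts_sum
    rw [ht, Multiset.sum_add] at this
    omega

open Classical in
lemma coeff_X_pow_mul_partsGE (D : Multiset ℕ) (m n : ℕ) (hD : ∀ i ∈ D, 0 < i ∧ m ≤ i) :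
    coeff n (X ^ D.sum * partsGE m) =
      ((univ.filter fun π : n.Partition => D ≤ π.parts ∧ ∀ i ∈ π.parts, m ≤ i).card : ℚ) := by
  rw [card_partition_containing D m n hD, coeff_X_pow_mul', partsGE]
  split_ifs <;> simp

lemma partsGE_succ (m : ℕ) :
    partsGE (m + 2) = (1 - X ^ (m + 1)) * partsGE (m + 1) := by
  classical
  ext n
  have h := coeff_X_pow_mul_partsGE {m + 1} (m + 1) n (by simp)
  rw [Multiset.sum_singleton] at h
  rw [sub_mul, one_mul, map_sub, h, eq_sub_iff_add_eq]
  simp only [partsGE, coeff_mk]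
  rw [← Nat.cast_add, ← card_union_of_disjoint]
  · congr 2
    ext π
    simp only [Multiset.singleton_le, mem_union, mem_filter, mem_univ, true_and]
    constructor
    · rintro (h | h)
      · exact fun i hi => (Nat.le_succ _).trans (h i hi)
      · exact h.2
    · intro h
      by_cases hm : m + 1 ∈ π.parts
      · exact Or.inr ⟨hm, h⟩
      · refine Or.inl fun i hi => Nat.lt_of_le_of_ne (h i hi) ?_
        rintro rfl
        exact hm hi
  · rw [disjoint_filter]
    rintro π - h ⟨hm, -⟩
    have := h _ (Multiset.singleton_le.1 hm)
    omega

lemma partsGE_eq (m : ℕ) : partsGE (m + 1) = qPoch m * partsGE 1 := by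
  induction m with
  | zero => simp [qPoch_zero]
  | succ m ih => rw [partsGE_succ, ih, qPoch_succ]; ring

lemma sum_range_ite_lt (n c : ℕ) (h : c ≤ n) :
    ∑ j ∈ range n, (if j < c then 1 else 0) = c := by
  rw [← sum_filter, ← card_eq_sum_ones]
  convert card_range c using 2
  ext j
  simp only [mem_filter, mem_range]
  omega

lemma count_le_of_partition {n : ℕ} (π : n.Partition) (i : ℕ) : π.parts.count i ≤ n := by
  have h : Multiset.replicate (π.parts.count i) i ≤ π.parts :=
    Multiset.le_count_iff_replicate_le.1 le_rfl
  obtain ⟨t, ht⟩ := Multiset.le_iff_exists_add.1 h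
  have hs := π.parts_sum
  by_cases hi : i ∈ π.parts
  · have := π.parts_pos hi
    rw [ht, Multiset.sum_add, Multiset.sum_replicate, smul_eq_mul] at hs
    exact (Nat.le_mul_of_pos_right _ this).trans ((Nat.le_add_right _ _).trans_eq hs)
  · simp [Multiset.count_eq_zero_of_notMem hi]

open Classical in
-- The two conditions force m + 1 to be the smallest part, with j indexing its copies.
lemma count_smallestPart {n : ℕ} (π : n.Partition) :
    π.parts.count (smallestPart π) = ∑ m ∈ range n, ∑ j ∈ range n,
      if Multiset.replicate (j + 1) (m + 1) ≤ π.parts ∧ ∀ i ∈ π.parts, m + 1 ≤ i then 1 else 0 := by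
  by_cases h0 : ∃ i, i ∈ π.parts
  · have hmem : smallestPart π ∈ π.parts := Nat.sInf_mem (s := {m | m ∈ π.parts}) h0
    have hle : ∀ i ∈ π.parts, smallestPart π ≤ i := fun i hi =>
      Nat.sInf_le (s := {m | m ∈ π.parts}) hi
    have hpos := π.parts_pos hmem
    have hn := Nat.Partition.le_of_mem_parts hmem
    obtain ⟨s, hs⟩ : ∃ s, smallestPart π = s + 1 := ⟨smallestPart π - 1, by omega⟩
    rw [hs] at hmem hle hn ⊢
    rw [sum_eq_single s]
    · rw [← sum_range_ite_lt n _ (count_le_of_partition π (s + 1))]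
      refine sum_congr rfl fun j _ => if_congr ?_ rfl rfl
      rw [← Multiset.le_count_iff_replicate_le]
      exact ⟨fun h => ⟨h, hle⟩, fun h => h.1⟩
    · intro m _ hms
      refine sum_eq_zero fun j _ => if_neg ?_
      rintro ⟨h1, h2⟩
      have h3 := hle _ (Multiset.mem_of_le h1 (by simp : m + 1 ∈ Multiset.replicate (j + 1) (m + 1)))
      have h4 := h2 _ hmem
      omega
    · intro h
      exact absurd (mem_range.2 (by omega)) h
  · have hz : π.parts = 0 := Multiset.eq_zero_of_forall_notMem fun i hi => h0 ⟨i, hi⟩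
    rw [sum_eq_zero]
    · simp [hz]
    · intro m _
      refine sum_eq_zero fun j _ => if_neg ?_
      rintro ⟨h1, -⟩
      exact h0 ⟨m + 1, Multiset.mem_of_le h1 (by simp)⟩

lemma spt_eq_coeff (n : ℕ) : (spt n : ℚ) =
    coeff n ((∑ m ∈ range n, ∑ j ∈ range n, qPoch m * X ^ ((j + 1) * (m + 1))) * partsGE 1) := by
  classical
  rw [spt, sum_congr rfl fun π _ => count_smallestPart π, sum_comm, sum_mul, map_sum, Nat.cast_sum]
  refine sum_congr rfl fun m _ => ?_
  rw [sum_comm, sum_mul, map_sum, Nat.cast_sum]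
  refine sum_congr rfl fun j _ => ?_
  have h := coeff_X_pow_mul_partsGE (Multiset.replicate (j + 1) (m + 1)) (m + 1) n (fun i hi => by
    rw [Multiset.eq_of_mem_replicate hi]; omega)
  rw [Multiset.sum_replicate, smul_eq_mul, partsGE_eq] at h
  rw [mul_comm (qPoch m), mul_assoc, h, card_filter]

/-! ### The mex and alternating sums -/

/-- The first `k` terms of the arithmetic progression `a, a + A, a + 2 A, …`. -/
def progression (A a k : ℕ) : Multiset ℕ := (Multiset.range k).map fun i => a + A * i

lemma sum_progression (A a k : ℕ) : (progression A a k).sum = arithSum A a k := rfl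

lemma progression_le_iff {A a k : ℕ} (hA : 0 < A) (s : Multiset ℕ) :
    progression A a k ≤ s ↔ ∀ i < k, a + A * i ∈ s := by
  have hnd : (progression A a k).Nodup :=
    (Multiset.nodup_range k).map fun i j h => by
      simpa [hA.ne'] using h
  rw [Multiset.le_iff_subset hnd]
  simp [progression, Multiset.subset_iff]

/-- The `A, a`-mex is `a + A k`, with `k` the length of the initial run of the progression. -/
lemma exists_mexAP_eq {A a n : ℕ} (hA : 0 < A) (ha : 0 < a) (π : n.Partition) :
    ∃ k ≤ n, mexAP A a π = a + A * k ∧ ∀ j, progression A a j ≤ π.parts ↔ j ≤ k := by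
  have hex : ∃ k, a + A * k ∉ π.parts := by
    -- Since A, a ≥ 1, the number a + A n exceeds n and cannot be a part.
    refine ⟨n, fun h => ?_⟩
    have := Nat.Partition.le_of_mem_parts h
    nlinarith
  classical
  refine ⟨Nat.find hex, ?_, ?_, ?_⟩
  · refine Nat.find_min' hex fun h => ?_
    have := Nat.Partition.le_of_mem_parts h
    nlinarith
  · refine le_antisymm (Nat.sInf_le ⟨Nat.le_add_right _ _, by simp [Nat.ModEq], Nat.find_spec hex⟩) ?_
    refine le_csInf ⟨_, Nat.le_add_right _ _, by simp [Nat.ModEq], Nat.find_spec hex⟩ ?_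
    rintro m ⟨h1, h2, h3⟩
    obtain ⟨c, hc⟩ := (Nat.modEq_iff_dvd' h1).1 h2.symm
    obtain rfl : m = a + A * c := by omega
    have := Nat.find_min' hex h3
    gcongr
  · intro j
    rw [progression_le_iff hA, Nat.le_find_iff]
    simp

lemma mexAP_modEq_iff_even {A a k : ℕ} (hA : 0 < A) : a + A * k ≡ a [MOD 2 * A] ↔ Even k := by
  rw [Nat.ModEq.comm, Nat.modEq_iff_dvd' (Nat.le_add_right _ _), Nat.add_sub_cancel_left, mul_comm 2,
    Nat.mul_dvd_mul_iff_left hA, even_iff_two_dvd]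

lemma mexAP_modEq_iff_odd {A a k : ℕ} (hA : 0 < A) :
    a + A * k ≡ A + a [MOD 2 * A] ↔ ¬ Even k := by
  rw [← Nat.even_add_one, ← mexAP_modEq_iff_even (a := a) hA, mul_add, mul_one, ← add_assoc]
  constructor <;> intro h
  · have := h.add_right A
    refine this.trans ?_
    simp [Nat.ModEq, show A + a + A = a + 2 * A by ring]
  · refine Nat.ModEq.add_right_cancel' A (h.trans ?_)
    simp [Nat.ModEq, show A + a + A = a + 2 * A by ring]

lemma pMex_add_pBarMex {A a : ℕ} (hA : 0 < A) (ha : 0 < a) (n : ℕ) :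
    pMex A a n + pBarMex A a n = Fintype.card n.Partition := by
  rw [pMex, pBarMex, ← card_univ,
    ← card_filter_add_card_filter_not (s := univ) (fun π : n.Partition => mexAP A a π ≡ a [MOD 2 * A])]
  congr 2
  ext π
  obtain ⟨k, -, hk, -⟩ := exists_mexAP_eq hA ha π
  simp only [mem_filter, mem_univ, true_and, hk, mexAP_modEq_iff_odd hA, mexAP_modEq_iff_even hA]

lemma sum_alternating_ite (n k : ℕ) (h : k ≤ n) :
    ∑ j ∈ range n, (-1 : ℚ) ^ j * (if j + 1 ≤ k then 1 else 0) = if ¬ Even k then 1 else 0 := by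
  induction k generalizing n with
  | zero => simp
  | succ k ih =>
    obtain ⟨n, rfl⟩ : ∃ m, n = m + 1 := ⟨n - 1, by omega⟩
    rw [sum_range_succ']
    have := ih n (by omega)
    simp only [pow_succ, Nat.add_le_add_iff_right, mul_neg, mul_one, neg_mul, sum_neg_distrib,
      Nat.even_add_one] at this ⊢
    rw [this]
    by_cases hk : Even k <;> simp [hk]

/-- The indicator that the run length k is odd is 1 - 1 + 1 - ⋯ with k terms; the term j records
that the first j + 1 members of the progression are parts. -/
lemma pBarMex_eq_coeff {A a : ℕ} (hA : 0 < A) (ha : 0 < a) (n : ℕ) : (pBarMex A a n : ℚ) =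
    coeff n ((∑ j ∈ range n, (-1) ^ j * X ^ arithSum A a (j + 1)) * partsGE 1) := by
  classical
  have h : ∀ j, coeff n ((-1) ^ j * X ^ arithSum A a (j + 1) * partsGE 1) =
      ∑ π : n.Partition, (-1 : ℚ) ^ j * if progression A a (j + 1) ≤ π.parts then 1 else 0 := by
    intro j
    have hD : ∀ i ∈ progression A a (j + 1), 0 < i ∧ 1 ≤ i := by
      simp only [progression, Multiset.mem_map]
      rintro i ⟨c, -, rfl⟩
      exact ⟨Nat.add_pos_left ha _, Nat.add_pos_left ha _⟩
    have hc := coeff_X_pow_mul_partsGE (progression A a (j + 1)) 1 n hD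
    rw [sum_progression] at hc
    rw [mul_assoc, show ((-1) ^ j : PowerSeries ℚ) = C ((-1) ^ j) by simp, coeff_C_mul, hc,
      ← mul_sum, card_filter]
    push_cast
    congr 1
    refine sum_congr rfl fun π _ => if_congr ?_ rfl rfl
    exact and_iff_left fun i hi => π.parts_pos hi
  rw [sum_mul, map_sum, sum_congr rfl fun j _ => h j, sum_comm, pBarMex, card_filter]
  push_cast
  refine sum_congr rfl fun π _ => ?_
  obtain ⟨k, hkn, hk, hp⟩ := exists_mexAP_eq hA ha π
  simp only [hk, hp, mexAP_modEq_iff_odd hA]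
  exact (sum_alternating_ite n k hkn).symm

end PartitionCounts

open PowerSeries Finset in
lemma spt_eq_sum_pBarMex (n : ℕ) : (spt n : ℤ) = ∑ r ∈ Finset.range n,
    (2 * (r : ℤ) + 1) * ((pBarMex 1 (r + 1) n : ℤ) - (pBarMex 3 (r + 2) n : ℤ)) := by
  have key : (spt n : ℚ) = ∑ r ∈ Finset.range n,
      (2 * (r : ℚ) + 1) * ((pBarMex 1 (r + 1) n : ℚ) - (pBarMex 3 (r + 2) n : ℚ)) := by
    have h := (andrews_identity_truncated n).mul_right (partsGE 1)
    have h1 := X_pow_dvd_iff.1 h n (Nat.lt_succ_self n)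
    rw [sub_mul, map_sub, sub_eq_zero, ← spt_eq_coeff] at h1
    rw [h1, sum_mul, map_sum]
    refine sum_congr rfl fun r _ => ?_
    rw [pBarMex_eq_coeff one_pos (Nat.succ_pos r), pBarMex_eq_coeff (by norm_num) (by omega),
      ← map_sub, ← sub_mul, ← sum_sub_distrib, mul_assoc,
      show (2 * (r : PowerSeries ℚ) + 1) = C (2 * (r : ℚ) + 1) by
        simp [show (C (2 : ℚ)) = (2 : PowerSeries ℚ) from map_ofNat C 2], coeff_C_mul]
    simp only [mul_sub]
  exact_mod_cast key

theorem corollary3p9 (n : ℕ) :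
    ((spt n : ℤ) = ∑ r ∈ Finset.range n,
      (2 * (r : ℤ) + 1) * ((pBarMex 1 (r + 1) n : ℤ) - (pBarMex 3 (r + 2) n : ℤ))) ∧
    ((spt n : ℤ) = ∑ r ∈ Finset.range n,
      (2 * (r : ℤ) + 1) * ((pMex 3 (r + 2) n : ℤ) - (pMex 1 (r + 1) n : ℤ))) := by
  refine ⟨spt_eq_sum_pBarMex n, (spt_eq_sum_pBarMex n).trans ?_⟩
  refine Finset.sum_congr rfl fun r _ => ?_
  -- Since p + p̄ counts all partitions for both parameter pairs, p̄_1 - p̄_3 = p_3 - p_1.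
  have h1 := pMex_add_pBarMex one_pos (Nat.succ_pos r) n
  have h3 := pMex_add_pBarMex (A := 3) (a := r + 2) (by norm_num) (by omega) n
  congr 1
  simp only [Nat.succ_eq_add_one] at h1
  omega
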